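/- Let $f\in\mathbb{C}[z_1^{\pm1},\dots,z_r^{\pm1}]$ be a Laurent polynomial and let $\mathcal{A}_f\subset\mathbb{R}^r$ be its amoeba, i.e. the image of $\{z\in(\mathbb{C}^*)^r : f(z)=0\}$ under $\mathrm{Log}(z)=(\log|z_1|,\dots,\log|z_r|)$. For $n\ge 1$ put $$f_n(z)=\prod_{k_1=0}^{n-1}\cdots\prod_{k_r=0}^{n-1} f\big(e^{2\pi i k_1/n}z_1,\dots,e^{2\pi i k_r/n}z_r\big).$$ For a Laurent polynomial $g$, written as the sum of its distinct nonzero monomials $m_1,\dots,m_N$, and $a\in\mathbb{R}^r$, let $g\{a\}$ be the list $|m_1(z)|,\dots,|m_N(z)|$, where $\mathrm{Log}(z)=a$ (it does not depend on the choice of $z$). A list $b_1,\dots,b_N$ of positive numbers is lopsided if some $b_i$ is greater than the sum of all the other entries, and superlopsided if there is an $i$ with $b_i>(N-1)b_j$ for all $j\neq i$. Let $\mathcal{LA}_g$ (resp. $\mathcal{SA}_g$) be the set of $a\in\mathbb{R}^r$ such that $g\{a\}$ is not lopsided (resp. not superlopsided). Then $\mathcal{SA}_{f_n}\supseteq\mathcal{LA}_{f_n}\supseteq\mathcal{A}_f$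 for all $n\ge1$, and both families $\mathcal{SA}_{f_n}$ and $\mathcal{LA}_{f_n}$ converge uniformly to $\mathcal{A}_f$ as $n\to\infty$, i.e. their Hausdorff distances to $\mathcal{A}_f$ (for the Euclidean metric) tend to $0$. Explicitly, suppose $f\neq0$, let $\Delta$ be its Newton polytope (the convex hull of the exponent vectors of the monomials of $f$), let $c=\max_i\,(\max_{\Delta}x_i-\min_{\Delta}x_i)$, and let $d$ be any real number with $\#(\mathbb{Z}^r\cap m\Delta)/m^r\le d$ for all integers $m\ge1$. Then for every $n\ge1$, every point of $\mathcal{SA}_{f_n}$ (hence also every point of $\mathcal{LA}_{f_n}$) is at Euclidean distance less than $$\frac1n\Big((r^2-1)\log n+\log\big(\tfrac{16}{3}\,c\,d\big)\Big)$$ from some point of $\mathcal{A}_f$. (If $f$ is a single monomial, so that $c=0$, then $\mathcal{SA}_{f_n}=\mathcal{LA}_{f_n}=\mathcal{A}_f=\emptyset$ and this claim is vacuous.) -/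

import Mathlib

open Filter Topology

open scoped Pointwise

namespace CyclicAmoeba

/-- Laurent polynomials `ℂ[z₁, z₁⁻¹, …, z_r, z_r⁻¹]`: the group algebra of `ℤ^r`.
The monomials of `f` are indexed by the finite set `f.coeff.support` of exponent vectors. -/
abbrev Laurent (r : ℕ) : Type := AddMonoidAlgebra ℂ (Fin r → ℤ)

/-- The value `f(z)` at a point `z` of the torus `(ℂ^*)^r`. -/
noncomputable def eval {r : ℕ} (f : Laurent r) (z : Fin r → ℂˣ) : ℂ :=
  f.coeff.sum fun j c => c * ∏ i, (z i : ℂ) ^ j i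

/-- `Log(z) = (log|z₁|, …, log|z_r|)`, with values in Euclidean space. -/
noncomputable def logMap {r : ℕ} (z : Fin r → ℂˣ) : EuclideanSpace ℝ (Fin r) :=
  WithLp.toLp 2 fun i => Real.log ‖(z i : ℂ)‖

/-- The amoeba of `f`: the image under `Log` of the zero locus of `f` in the torus. -/
def amoeba {r : ℕ} (f : Laurent r) : Set (EuclideanSpace ℝ (Fin r)) :=
  logMap '' {z | eval f z = 0}

/-- The Laurent polynomial `f(u₁ z₁, …, u_r z_r)`. -/
noncomputable def rescale {r : ℕ} (u : Fin r → ℂˣ) (f : Laurent r) : Laurent r :=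
  f.coeff.sum fun j c => AddMonoidAlgebra.single j (c * ∏ i, (u i : ℂ) ^ j i)

/-- The root of unity `e^{2 π i k / n}`. -/
noncomputable def rootOfUnity (n k : ℕ) : ℂˣ :=
  Units.mk0 (Complex.exp (2 * Real.pi * Complex.I * k / n)) (Complex.exp_ne_zero _)

/-- The iterated cyclic resultant
`f_n(z) = ∏_{k₁ = 0}^{n-1} ⋯ ∏_{k_r = 0}^{n-1} f(e^{2πi k₁/n} z₁, …, e^{2πi k_r/n} z_r)`. -/
noncomputable def cyclicResultant {r : ℕ} (n : ℕ) (f : Laurent r) : Laurent r :=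
  ∏ k : Fin r → Fin n, rescale (fun i => rootOfUnity n (k i)) f

/-- The absolute value of the monomial of `f` with exponent vector `j` at any point of
`Log⁻¹(a)`. The list `f{a}` is the family of these numbers, `j ∈ f.coeff.support`. -/
noncomputable def monomialAbs {r : ℕ} (f : Laurent r) (a : EuclideanSpace ℝ (Fin r))
    (j : Fin r → ℤ) : ℝ :=
  ‖f.coeff j‖ * ∏ i, Real.exp (a i) ^ j i

/-- A list `(b j)_{j ∈ s}` is lopsided if one of its entries is greater than the sum of all
the others. -/
def Lopsided {ι : Type*} [DecidableEq ι] (s : Finset ι) (b : ι → ℝ) : Prop :=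
  ∃ i ∈ s, ∑ j ∈ s.erase i, b j < b i

/-- A list `(b j)_{j ∈ s}` with `D + 1` entries is superlopsided if one of its entries is greater
than `D` times each of the others. -/
def Superlopsided {ι : Type*} (s : Finset ι) (b : ι → ℝ) : Prop :=
  ∃ i ∈ s, ∀ j ∈ s, j ≠ i → ((s.card : ℝ) - 1) * b j < b i

/-- The points `a` at which the list `f{a}` is not lopsided. -/
def nonLopsidedSet {r : ℕ} (f : Laurent r) : Set (EuclideanSpace ℝ (Fin r)) :=
  {a | ¬ Lopsided f.coeff.support (monomialAbs f a)}

/-- The points `a` at which the list `f{a}` is not superlopsided. -/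
def nonSuperlopsidedSet {r : ℕ} (f : Laurent r) : Set (EuclideanSpace ℝ (Fin r)) :=
  {a | ¬ Superlopsided f.coeff.support (monomialAbs f a)}

/-- The Newton polytope `Δ(f)`: the convex hull of the exponent vectors of `f`. -/
def newtonPolytope {r : ℕ} (f : Laurent r) : Set (Fin r → ℝ) :=
  convexHull ℝ ((fun (j : Fin r → ℤ) (i : Fin r) => (j i : ℝ)) '' (f.coeff.support : Set _))

/-- `d` is an upper bound for `#(ℤ^r ∩ mΔ) / m^r`, over all positive integers `m`. -/
def IsLatticePointBound {r : ℕ} (Δ : Set (Fin r → ℝ)) (d : ℝ) : Prop :=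
  ∀ m : ℕ, 1 ≤ m →
    ({p : Fin r → ℤ | (fun i => (p i : ℝ)) ∈ (m : ℝ) • Δ}.ncard : ℝ) / (m : ℝ) ^ r ≤ d

/-- `c = max_i c_i(f)`, where `c_i(f) = max x_i(Δ(f)) - min x_i(Δ(f))`. -/
noncomputable def width {r : ℕ} (f : Laurent r) : ℝ :=
  ⨆ i : Fin r, (sSup ((fun x => x i) '' newtonPolytope f)
    - sInf ((fun x => x i) '' newtonPolytope f))

end CyclicAmoeba

namespace CyclicAmoeba

/-! Suppose `a` is at distance at least `ε` from the amoeba. Freeze all variables but the `i`-th on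
the torus over `a`: `f` becomes a monomial times a polynomial in `w` of degree at most the width
`c`. Changing only `w` changes only the `i`-th coordinate of `Log`, so each nonzero root `ρ`
satisfies `|log|ρ| - a i| ≥ ε`. Multiplying over the `n` rotations of `w` turns each root factor
into `±(ρ^n - w^n)`, a monomial up to relative error `γ = e^{-nε}`. Over all rotations of the other
variables, `f_n` is a monomial in `w` up to a product of at most `K = n^(r-1) ⌊c⌋` such factors,
hence up to `δ = (1+γ)^K - 1` (`exists_nearMonomial_eval_cyclicResultant`).

Fourier analysis in one variable then shows that at each point of the torus one slice `q i = p i` of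
`f_n` dominates the others. By connectedness `p i` is the same everywhere. A coefficient with `q ≠
p` lies in a dominated slice for some `i`, so it is small compared with the sum of all absolute
values, and the coefficient at `p` must be large (`exists_dominant_coeff`).

To compare `δ` with the number of terms: the exponents of `f_n` lie in `n^r Δ` and are divisible by
`n`, so there are at most `d n^((r-1)r)` of them. With `K ≤ c n^(r-1)` this produces the power
`n^(r²-1)` and the stated `ε`. -/

/-! ### Fourier coefficients of trigonometric polynomials -/

/-- The sum of a full set of values of a nontrivial additive character of period `N`. -/
theorem sum_exp_int_mul (N : ℕ) (m : ℤ) (hm : |m| < N) :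
    ∑ k ∈ Finset.range N, Complex.exp (Complex.I * m * ((2 * Real.pi * k / N : ℝ) : ℂ)) =
      if m = 0 then (N : ℂ) else 0 := by
  have hN : (N : ℂ) ≠ 0 := by
    have : 0 < N := by have := abs_nonneg m; omega
    exact_mod_cast this.ne'
  split_ifs with h
  · simp [h]
  · set x : ℂ := Complex.exp (2 * Real.pi * Complex.I * (m / N)) with hx
    have hpow : ∀ k : ℕ, Complex.exp (Complex.I * m * ((2 * Real.pi * k / N : ℝ) : ℂ)) = x ^ k := by
      intro k
      rw [hx, ← Complex.exp_nat_mul]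
      congr 1
      push_cast
      field_simp
    simp_rw [hpow]
    have hx1 : x ≠ 1 := by
      rw [hx, Ne, Complex.exp_eq_one_iff]
      rintro ⟨l, hl⟩
      have h2 : (m : ℂ) / N = l := by
        have := Complex.two_pi_I_ne_zero
        rw [mul_comm (l : ℂ)] at hl
        exact mul_left_cancel₀ this hl
      rw [div_eq_iff hN] at h2
      have h3 : m = l * N := by exact_mod_cast h2
      rw [h3, abs_mul] at hm
      have hl0 : l ≠ 0 := by rintro rfl; simp at h3; exact h h3
      have := Int.one_le_abs hl0
      rw [Nat.abs_cast] at hm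
      nlinarith
    have hxN : x ^ N = 1 := by
      rw [hx, ← Complex.exp_nat_mul, Complex.exp_eq_one_iff]
      exact ⟨m, by field_simp⟩
    have := mul_geom_sum x N
    rw [hxN, sub_self] at this
    exact (mul_eq_zero.mp this).resolve_left (sub_ne_zero.mpr hx1)

/-- A coefficient of a trigonometric polynomial in one variable is bounded by its sup norm. -/
theorem norm_coeff_le_of_norm_le {ι : Type*} (S : Finset ι) (e : ι → ℤ) (c : ι → ℂ) (M : ℝ)
    (h : ∀ s : ℝ, ‖∑ q ∈ S, c q * Complex.exp (Complex.I * e q * s)‖ ≤ M) (t : ℤ) :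
    ‖∑ q ∈ S, if e q = t then c q else 0‖ ≤ M := by
  -- `N` exceeds every `|e q - t|`, so averaging over `N` equally spaced points isolates frequency
  -- `t` without aliasing.
  obtain ⟨N, hN0, hN⟩ : ∃ N : ℕ, 0 < N ∧ ∀ q ∈ S, |e q - t| < N := by
    refine ⟨1 + ∑ q ∈ S, (e q - t).natAbs, by omega, fun q hq => ?_⟩
    have : (e q - t).natAbs ≤ ∑ q ∈ S, (e q - t).natAbs :=
      Finset.single_le_sum (f := fun q => (e q - t).natAbs) (fun _ _ => Nat.zero_le _) hq
    rw [Int.abs_eq_natAbs]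
    omega
  have hNC : (N : ℂ) ≠ 0 := by exact_mod_cast hN0.ne'
  have key : ∑ k ∈ Finset.range N,
      Complex.exp (-(Complex.I * t * ((2 * Real.pi * k / N : ℝ) : ℂ))) *
        ∑ q ∈ S, c q * Complex.exp (Complex.I * e q * ((2 * Real.pi * k / N : ℝ) : ℂ)) =
      N * ∑ q ∈ S, if e q = t then c q else 0 := by
    simp_rw [Finset.mul_sum]
    rw [Finset.sum_comm]
    refine Finset.sum_congr rfl fun q hq => ?_
    have := sum_exp_int_mul N (e q - t) (hN q hq)
    simp only [sub_eq_zero] at this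
    have h2 : (N : ℂ) * (if e q = t then c q else 0) = c q * if e q = t then (N : ℂ) else 0 := by
      split_ifs <;> ring
    rw [h2, ← this, Finset.mul_sum]
    refine Finset.sum_congr rfl fun k _ => ?_
    rw [mul_left_comm, ← Complex.exp_add]
    congr 2
    push_cast
    ring
  have hnorm : (N : ℝ) * ‖∑ q ∈ S, if e q = t then c q else 0‖ ≤ N * M := by
    rw [← Complex.norm_natCast, ← norm_mul, ← key, Complex.norm_natCast]
    refine (norm_sum_le _ _).trans ?_
    refine (Finset.sum_le_card_nsmul _ _ M fun k _ => ?_).trans_eq (by simp)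
    rw [norm_mul]
    have : Complex.exp (-(Complex.I * t * ((2 * Real.pi * k / N : ℝ) : ℂ))) =
        Complex.exp (((-(t * (2 * Real.pi * k / N)) : ℝ) : ℂ) * Complex.I) := by
      congr 1
      push_cast
      ring
    rw [this, Complex.norm_exp_ofReal_mul_I, one_mul]
    exact h _
  exact le_of_mul_le_mul_left hnorm (by exact_mod_cast hN0)

/-- The trigonometric polynomial with coefficients `c` and frequencies in `S`. -/
noncomputable def trigPoly {r : ℕ} (S : Finset (Fin r → ℤ)) (c : (Fin r → ℤ) → ℂ)
    (θ : Fin r → ℝ) : ℂ :=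
  ∑ q ∈ S, c q * Complex.exp (Complex.I * ∑ i, (q i : ℂ) * θ i)

theorem continuous_trigPoly {r : ℕ} (S : Finset (Fin r → ℤ)) (c : (Fin r → ℤ) → ℂ) :
    Continuous (trigPoly S c) := by
  unfold trigPoly
  fun_prop

theorem norm_trigPoly_le {r : ℕ} (S : Finset (Fin r → ℤ)) (c : (Fin r → ℤ) → ℂ)
    (θ : Fin r → ℝ) : ‖trigPoly S c θ‖ ≤ ∑ q ∈ S, ‖c q‖ := by
  refine (norm_sum_le _ _).trans (Finset.sum_le_sum fun q _ => ?_)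
  have : Complex.I * ∑ i, (q i : ℂ) * θ i = ((∑ i, (q i : ℝ) * θ i : ℝ) : ℂ) * Complex.I := by
    push_cast
    ring
  rw [norm_mul, this, Complex.norm_exp_ofReal_mul_I, mul_one]

theorem trigPoly_add_single {r : ℕ} (S : Finset (Fin r → ℤ)) (c : (Fin r → ℤ) → ℂ)
    (θ : Fin r → ℝ) (i : Fin r) (s : ℝ) :
    trigPoly S c (θ + Pi.single i s) =
      ∑ q ∈ S, (c q * Complex.exp (Complex.I * ∑ l, (q l : ℂ) * θ l)) *
        Complex.exp (Complex.I * q i * s) := by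
  refine Finset.sum_congr rfl fun q _ => ?_
  rw [mul_assoc, ← Complex.exp_add]
  congr 2
  have : ∑ l, (q l : ℂ) * ((Pi.single i s : Fin r → ℝ) l : ℂ) = q i * s := by
    rw [Finset.sum_eq_single i] <;> simp +contextual
  simp only [Pi.add_apply, Complex.ofReal_add, mul_add, Finset.sum_add_distrib, this]
  ring

theorem trigPoly_filter {r : ℕ} (S : Finset (Fin r → ℤ)) (c : (Fin r → ℤ) → ℂ)
    (θ : Fin r → ℝ) (i : Fin r) (t : ℤ) :
    trigPoly (S.filter fun q => q i = t) c θ =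
      ∑ q ∈ S, if q i = t then c q * Complex.exp (Complex.I * ∑ l, (q l : ℂ) * θ l) else 0 := by
  rw [trigPoly, Finset.sum_filter]

/-- Selecting the frequencies with one prescribed component does not increase the sup norm. -/
theorem norm_trigPoly_filter_le {r : ℕ} (S : Finset (Fin r → ℤ)) (c : (Fin r → ℤ) → ℂ) (M : ℝ)
    (h : ∀ θ, ‖trigPoly S c θ‖ ≤ M) (i : Fin r) (t : ℤ) (θ : Fin r → ℝ) :
    ‖trigPoly (S.filter fun q => q i = t) c θ‖ ≤ M := by
  rw [trigPoly_filter]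
  refine norm_coeff_le_of_norm_le S (fun q => q i) _ M (fun s => ?_) t
  rw [← trigPoly_add_single]
  exact h _

/-- A coefficient of a trigonometric polynomial is bounded by its sup norm. -/
theorem norm_coeff_le_of_norm_trigPoly_le {r : ℕ} (S : Finset (Fin r → ℤ))
    (c : (Fin r → ℤ) → ℂ) (M : ℝ) (h : ∀ θ, ‖trigPoly S c θ‖ ≤ M) {q : Fin r → ℤ}
    (hq : q ∈ S) : ‖c q‖ ≤ M := by
  -- Fix the components of the frequency one at a time; after all of them only `q` is left.
  have key : ∀ J : Finset (Fin r), ∀ θ,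
      ‖trigPoly (S.filter fun q' => ∀ j ∈ J, q' j = q j) c θ‖ ≤ M := by
    intro J
    induction J using Finset.induction_on with
    | empty => simpa using h
    | insert i J _ ih =>
      intro θ
      have := norm_trigPoly_filter_le _ c M ih i (q i) θ
      rw [Finset.filter_filter] at this
      convert this using 5
      simp [and_comm]
  have h1 := key Finset.univ 0
  have h2 : (S.filter fun q' => ∀ j ∈ Finset.univ, q' j = q j) = {q} := by
    ext q'
    rw [Finset.mem_filter, Finset.mem_singleton]
    exact ⟨fun h => funext fun j => h.2 j (Finset.mem_univ j), fun h => h.symm ▸ ⟨hq, fun _ _ => rfl⟩⟩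
  rw [h2] at h1
  simpa [trigPoly] using h1

/-- If a trigonometric polynomial is uniformly close to a monomial in one of its variables, then
the part with the corresponding frequency is close to that monomial and the others are small. -/
theorem norm_trigPoly_filter_sub_le {r : ℕ} (S : Finset (Fin r → ℤ)) (c : (Fin r → ℤ) → ℂ)
    (θ : Fin r → ℝ) (i : Fin r) (C : ℂ) (p : ℤ) (M : ℝ)
    (h : ∀ s : ℝ, ‖trigPoly S c (θ + Pi.single i s) - C * Complex.exp (Complex.I * p * s)‖ ≤ M)
    (t : ℤ) :
    ‖trigPoly (S.filter fun q => q i = t) c θ - if p = t then C else 0‖ ≤ M := by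
  -- The subtracted monomial enters as one more term, indexed by `none`, with frequency `p` and
  -- coefficient `-C`.
  have := norm_coeff_le_of_norm_le (Finset.insertNone S)
    (fun o => o.elim p fun q => q i)
    (fun o => o.elim (-C) fun q => c q * Complex.exp (Complex.I * ∑ l, (q l : ℂ) * θ l)) M
    (fun s => by
      rw [Finset.sum_insertNone]
      simp only [Option.elim_none, Option.elim_some]
      rw [← trigPoly_add_single, neg_mul, neg_add_eq_sub]
      exact h s) t
  rw [Finset.sum_insertNone] at this
  simp only [Option.elim_none, Option.elim_some] at this
  have h2 := trigPoly_filter S c θ i t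
  convert this using 2
  rw [h2, sub_eq_neg_add]
  congr 1
  have h3 : -(if p = t then C else 0) = if p = t then -C else 0 := by split_ifs <;> simp
  exact h3

/-! ### Existence of a dominant coefficient -/

/-- A family of continuous functions on a preconnected space, of which at every point one
dominates all others by a factor `η < 1`: the index of the dominant one is constant. -/
theorem exists_dominant_of_preconnected {X : Type*} [TopologicalSpace X] [PreconnectedSpace X]
    [Nonempty X] (g : ℤ → X → ℂ) (hg : ∀ t, Continuous (g t)) (T : Finset ℤ)
    (hT : ∀ t ∉ T, ∀ x, g t x = 0) (η : ℝ) (hη : η < 1)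
    (h : ∀ x, ∃ p, g p x ≠ 0 ∧ ∀ t, t ≠ p → ‖g t x‖ ≤ η * ‖g p x‖) :
    ∃ p, ∀ x, ∀ t, t ≠ p → ‖g t x‖ ≤ η * ‖g p x‖ := by
  choose P hP0 hP using h
  have hlt : ∀ x t, t ≠ P x → ‖g t x‖ < ‖g (P x) x‖ := fun x t ht =>
    (hP x t ht).trans_lt (mul_lt_of_lt_one_left (norm_pos_iff.mpr (hP0 x)) hη)
  have hloc : IsLocallyConstant P := by
    rw [IsLocallyConstant.iff_eventually_eq]
    intro x
    -- Strict dominance over the finitely many indices in `T` persists nearby, and a dominant index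
    -- lies in `T` because the other functions vanish.
    have hev : ∀ᶠ y in 𝓝 x, ∀ t ∈ T, t ≠ P x → ‖g t y‖ < ‖g (P x) y‖ := by
      rw [Filter.eventually_all_finset]
      intro t _
      by_cases ht : t = P x
      · simp [ht]
      · filter_upwards [(hg t).norm.continuousAt.eventually_lt (hg (P x)).norm.continuousAt
          (hlt x t ht)] with y hy _
        exact hy
    filter_upwards [hev] with y hy
    by_contra hne
    have hmem : P y ∈ T := by
      by_contra hT'
      exact hP0 y (hT _ hT' y)
    exact lt_asymm (hy _ hmem hne) (hlt y _ (Ne.symm hne))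
  obtain ⟨x₀⟩ := ‹Nonempty X›
  refine ⟨P x₀, fun x t ht => ?_⟩
  have := hloc.apply_eq_of_preconnectedSpace x x₀
  rw [← this] at ht ⊢
  exact hP x t ht

/-- If a trigonometric polynomial is, in each variable separately, uniformly close to a monomial,
then one of its coefficients dominates all the others. -/
theorem exists_dominant_coeff {r : ℕ} (S : Finset (Fin r → ℤ)) (c : (Fin r → ℤ) → ℂ)
    (hc : ∀ q ∈ S, c q ≠ 0) (D : ℕ) (hD : 1 ≤ D) (hS : S.card = D + 1) (δ : ℝ) (hδ : 0 ≤ δ)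
    (hδD : (2 * D + 1) * δ < 1)
    (h : ∀ (i : Fin r) (θ : Fin r → ℝ), ∃ C : ℂ, C ≠ 0 ∧ ∃ p : ℤ, ∀ s : ℝ,
      ‖trigPoly S c (θ + Pi.single i s) - C * Complex.exp (Complex.I * p * s)‖ ≤ δ * ‖C‖) :
    ∃ p ∈ S, ∀ q ∈ S, q ≠ p → D * ‖c q‖ < ‖c p‖ := by
  have hD1 : (1 : ℝ) ≤ D := by exact_mod_cast hD
  have hδ1 : 0 < 1 - δ := by nlinarith
  -- The dominant slice has size at least `(1 - δ)‖C‖` and the others at most `δ‖C‖`.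
  set η : ℝ := δ / (1 - δ) with hη
  have hη0 : 0 ≤ η := by positivity
  have hηD : 2 * D * η < 1 := by
    rw [hη, mul_div_assoc', div_lt_one hδ1]
    linarith
  have hη1 : η < 1 := by nlinarith
  have hdom : ∀ i : Fin r, ∃ p : ℤ, ∀ θ, ∀ t, t ≠ p →
      ‖trigPoly (S.filter fun q => q i = t) c θ‖ ≤
        η * ‖trigPoly (S.filter fun q => q i = p) c θ‖ := by
    intro i
    refine exists_dominant_of_preconnected
      (fun t => trigPoly (S.filter fun q => q i = t) c) (fun t => continuous_trigPoly _ _)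
      (S.image fun q => q i) (fun t ht θ => ?_) η hη1 (fun θ => ?_)
    · have : (S.filter fun q => q i = t) = ∅ := by
        rw [Finset.filter_eq_empty_iff]
        intro q hq hqt
        exact ht (Finset.mem_image.mpr ⟨q, hq, hqt⟩)
      simp [this, trigPoly]
    · obtain ⟨C, hC, p, hp⟩ := h i θ
      have hsub := norm_trigPoly_filter_sub_le S c θ i C p _ hp
      have hCpos := norm_pos_iff.mpr hC
      have hbig : (1 - δ) * ‖C‖ ≤ ‖trigPoly (S.filter fun q => q i = p) c θ‖ := by
        have h1 := hsub p
        rw [if_pos rfl] at h1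
        have h2 := norm_sub_norm_le C (trigPoly (S.filter fun q => q i = p) c θ)
        rw [norm_sub_rev] at h2
        linarith
      refine ⟨p, ?_, fun t ht => ?_⟩
      · rw [← norm_pos_iff]
        exact (mul_pos hδ1 hCpos).trans_le hbig
      · have h1 := hsub t
        rw [if_neg (Ne.symm ht), sub_zero] at h1
        refine h1.trans ?_
        calc δ * ‖C‖ = η * ((1 - δ) * ‖C‖) := by rw [hη]; field_simp
          _ ≤ _ := by gcongr
  choose p hp using hdom
  set B := ∑ q ∈ S, ‖c q‖ with hB
  have hBpos : 0 < B := by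
    have hne : S.Nonempty := Finset.card_pos.mp (by omega)
    exact Finset.sum_pos (fun q hq => norm_pos_iff.mpr (hc q hq)) hne
  have hsmall : ∀ q ∈ S, q ≠ p → ‖c q‖ ≤ η * B := by
    intro q hq hqp
    obtain ⟨i, hi⟩ := Function.ne_iff.mp hqp
    refine norm_coeff_le_of_norm_trigPoly_le (S.filter fun q' => q' i = q i) c _ (fun θ => ?_)
      (Finset.mem_filter.mpr ⟨hq, rfl⟩)
    refine (hp i θ _ hi).trans ?_
    gcongr
    refine (norm_trigPoly_le _ _ _).trans ?_
    exact Finset.sum_le_sum_of_subset_of_nonneg (Finset.filter_subset _ _)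
      fun _ _ _ => norm_nonneg _
  -- Otherwise all `D + 1` coefficients would be at most `η B`, giving `B ≤ (D + 1) η B < B`.
  have hpS : p ∈ S := by
    by_contra hpS
    have h1 : B ≤ S.card • (η * B) := Finset.sum_le_card_nsmul _ _ _ fun q hq =>
      hsmall q hq fun h => hpS (h ▸ hq)
    rw [hS, nsmul_eq_mul] at h1
    push_cast at h1
    have h2 : (D + 1) * η < 1 := by nlinarith
    nlinarith
  refine ⟨p, hpS, fun q hq hqp => ?_⟩
  -- Thus `‖c p‖ ≥ (1 - Dη) B`, which exceeds `DηB` because `2Dη < 1`.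
  have h1 : B - ‖c p‖ ≤ D * (η * B) := by
    have h2 : ∑ q ∈ S.erase p, ‖c q‖ ≤ (S.erase p).card • (η * B) :=
      Finset.sum_le_card_nsmul _ _ _ fun q hq =>
        hsmall q (Finset.mem_of_mem_erase hq) (Finset.ne_of_mem_erase hq)
    rw [Finset.card_erase_of_mem hpS, hS, nsmul_eq_mul, Nat.add_sub_cancel] at h2
    have h3 := Finset.add_sum_erase S (fun q => ‖c q‖) hpS
    linarith
  have h4 : (D : ℝ) * ‖c q‖ ≤ D * (η * B) := by
    gcongr
    exact hsmall q hq hqp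
  nlinarith

/-! ### Functions close to a monomial on a circle -/

/-- The complex numbers `u` with `‖u - 1‖ ≤ (1 + γ)^K - 1`. These contain the products of `K`
numbers at distance at most `γ` from `1`. -/
def NearOne (γ : ℝ) (K : ℕ) (u : ℂ) : Prop := ‖u - 1‖ ≤ (1 + γ) ^ K - 1

theorem NearOne.mul {γ : ℝ} {K L : ℕ} {u v : ℂ} (hu : NearOne γ K u) (hv : NearOne γ L v) :
    NearOne γ (K + L) (u * v) := by
  unfold NearOne at *
  have h : u * v - 1 = (u - 1) * (v - 1) + (u - 1) + (v - 1) := by ring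
  have h1 : ‖(u - 1) * (v - 1)‖ ≤ ((1 + γ) ^ K - 1) * ((1 + γ) ^ L - 1) := by
    rw [norm_mul]
    exact mul_le_mul hu hv (norm_nonneg _) ((norm_nonneg _).trans hu)
  rw [h, pow_add]
  refine norm_add₃_le.trans ?_
  linarith

theorem NearOne.mono {γ : ℝ} (hγ : 0 ≤ γ) {K L : ℕ} (hKL : K ≤ L) {u : ℂ} (hu : NearOne γ K u) :
    NearOne γ L u :=
  le_trans hu (sub_le_sub_right (pow_le_pow_right₀ (by linarith) hKL) 1)

/-- On the circle of radius `R`, the function `g` is a Laurent monomial up to an error factor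
in `NearOne γ K`. -/
def NearMonomial (γ : ℝ) (K : ℕ) (R : ℝ) (g : ℂ → ℂ) : Prop :=
  ∃ C : ℂ, C ≠ 0 ∧ ∃ p : ℤ, ∀ w : ℂ, ‖w‖ = R → ∃ u, NearOne γ K u ∧ g w = C * w ^ p * u

theorem nearMonomial_const_mul_zpow (γ R : ℝ) {C : ℂ} (hC : C ≠ 0) (p : ℤ) :
    NearMonomial γ 0 R fun w => C * w ^ p :=
  ⟨C, hC, p, fun _ _ => ⟨1, by simp [NearOne], by simp⟩⟩

theorem nearMonomial_const (γ R : ℝ) {C : ℂ} (hC : C ≠ 0) : NearMonomial γ 0 R fun _ => C := by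
  simpa using nearMonomial_const_mul_zpow γ R hC 0

theorem NearMonomial.mul {γ R : ℝ} (hR : 0 < R) {K L : ℕ} {g h : ℂ → ℂ}
    (hg : NearMonomial γ K R g) (hh : NearMonomial γ L R h) :
    NearMonomial γ (K + L) R fun w => g w * h w := by
  obtain ⟨C, hC, p, hg⟩ := hg
  obtain ⟨C', hC', p', hh⟩ := hh
  refine ⟨C * C', mul_ne_zero hC hC', p + p', fun w hw => ?_⟩
  obtain ⟨u, hu, hgu⟩ := hg w hw
  obtain ⟨v, hv, hhv⟩ := hh w hw
  have hw0 : w ≠ 0 := norm_pos_iff.mp (hw ▸ hR)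
  refine ⟨u * v, hu.mul hv, ?_⟩
  simp only [hgu, hhv, zpow_add₀ hw0]
  ring

theorem NearMonomial.mono {γ R : ℝ} (hγ : 0 ≤ γ) {K L : ℕ} (hKL : K ≤ L) {g : ℂ → ℂ}
    (hg : NearMonomial γ K R g) : NearMonomial γ L R g := by
  obtain ⟨C, hC, p, hg⟩ := hg
  refine ⟨C, hC, p, fun w hw => ?_⟩
  obtain ⟨u, hu, h⟩ := hg w hw
  exact ⟨u, hu.mono hγ hKL, h⟩

theorem NearMonomial.prod {γ R : ℝ} (hR : 0 < R) {K : ℕ} {ι : Type*} (s : Finset ι)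
    (g : ι → ℂ → ℂ) (hg : ∀ i ∈ s, NearMonomial γ K R (g i)) :
    NearMonomial γ (s.card * K) R fun w => ∏ i ∈ s, g i w := by
  classical
  induction s using Finset.induction_on with
  | empty => simpa using nearMonomial_const γ R one_ne_zero
  | insert i s his ih =>
    have := (hg i (Finset.mem_insert_self i s)).mul hR
      (ih fun j hj => hg j (Finset.mem_insert_of_mem hj))
    simp_rw [Finset.prod_insert his]
    rw [Finset.card_insert_of_notMem his, add_mul, one_mul, add_comm]
    exact this

/-- A binomial whose two terms have very different sizes on the circle of radius `R`. -/
theorem nearMonomial_pow_sub_pow {γ R : ℝ} (hR : 0 < R) (n : ℕ) (ρ : ℂ)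
    (hρ : ‖ρ‖ ^ n ≤ γ * R ^ n ∨ R ^ n ≤ γ * ‖ρ‖ ^ n) :
    NearMonomial γ 1 R fun w => ρ ^ n - w ^ n := by
  have hRn : 0 < R ^ n := pow_pos hR n
  rcases hρ with h | h
  · refine ⟨-1, by simp, n, fun w hw => ⟨1 - (ρ / w) ^ n, ?_, ?_⟩⟩
    · have : ‖(1 - (ρ / w) ^ n) - 1‖ = ‖ρ‖ ^ n / R ^ n := by
        rw [sub_sub_cancel_left, norm_neg, norm_pow, norm_div, hw, div_pow]
      rw [NearOne, this, div_le_iff₀ hRn]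
      linarith
    · have hw0 : w ≠ 0 := norm_pos_iff.mp (hw ▸ hR)
      rw [zpow_natCast, div_pow]
      field_simp
      ring
  · have hρn : ρ ^ n ≠ 0 := by
      intro h0
      have : ‖ρ‖ ^ n = 0 := by rw [← norm_pow, h0, norm_zero]
      rw [this, mul_zero] at h
      exact absurd hRn (not_lt.mpr h)
    refine ⟨ρ ^ n, hρn, 0, fun w hw => ⟨1 - w ^ n / ρ ^ n, ?_, ?_⟩⟩
    · have : ‖(1 - w ^ n / ρ ^ n) - 1‖ = R ^ n / ‖ρ‖ ^ n := by
        rw [sub_sub_cancel_left, norm_neg, norm_div, norm_pow, norm_pow, hw]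
      have hpos : 0 < ‖ρ‖ ^ n := by rw [← norm_pow]; exact norm_pos_iff.mpr hρn
      rw [NearOne, this, div_le_iff₀ hpos]
      linarith
    · field_simp

/-- Evaluate the factorization `X^n - w^n = ∏ (X - ζ^k w)` at `ρ`; the sign comes from reversing the
`n` factors. -/
theorem prod_primitiveRoot_mul_sub {n : ℕ} (hn : 0 < n) {ζ : ℂ} (hζ : IsPrimitiveRoot ζ n)
    (w ρ : ℂ) : ∏ k : Fin n, (ζ ^ (k : ℕ) * w - ρ) = (-1) ^ n * (ρ ^ n - w ^ n) := by
  have h := congrArg (Polynomial.eval ρ) (X_pow_sub_C_eq_prod hζ hn (rfl : w ^ n = w ^ n))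
  rw [Polynomial.eval_prod] at h
  simp only [Polynomial.eval_sub, Polynomial.eval_pow, Polynomial.eval_X, Polynomial.eval_C] at h
  rw [h, Fin.prod_univ_eq_prod_range (fun k => ζ ^ k * w - ρ) n]
  have h2 : ((-1 : ℂ)) ^ n = ∏ _k ∈ Finset.range n, (-1 : ℂ) := by simp
  rw [h2, ← Finset.prod_mul_distrib]
  exact Finset.prod_congr rfl fun k _ => by ring

/-- If all roots of `P` are far from the circle of radius `R`, then the product of the rotations
of `P` by `n`-th roots of unity is close to a monomial on that circle. -/
theorem nearMonomial_prod_eval {γ R : ℝ} (hR : 0 < R) {n : ℕ} (hn : 0 < n) {ζ : ℂ}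
    (hζ : IsPrimitiveRoot ζ n) (P : Polynomial ℂ) (hP : P ≠ 0)
    (hroots : ∀ ρ, P.IsRoot ρ → ‖ρ‖ ^ n ≤ γ * R ^ n ∨ R ^ n ≤ γ * ‖ρ‖ ^ n) :
    NearMonomial γ P.natDegree R fun w => ∏ k : Fin n, P.eval (ζ ^ (k : ℕ) * w) := by
  have hsplit : P.Splits := IsAlgClosed.splits P
  have key : ∀ s : Multiset ℂ, (∀ ρ ∈ s, ‖ρ‖ ^ n ≤ γ * R ^ n ∨ R ^ n ≤ γ * ‖ρ‖ ^ n) →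
      NearMonomial γ s.card R
        fun w => ∏ k : Fin n, (s.map fun ρ => ζ ^ (k : ℕ) * w - ρ).prod := by
    intro s
    induction s using Multiset.induction_on with
    | empty => intro _; simpa using nearMonomial_const γ R one_ne_zero
    | cons ρ s ih =>
      intro hs
      have h1 := (nearMonomial_pow_sub_pow hR n ρ (hs ρ (Multiset.mem_cons_self ρ s))).mul hR
        (ih fun σ hσ => hs σ (Multiset.mem_cons_of_mem hσ))
      have h2 := (nearMonomial_const γ R (pow_ne_zero n (neg_ne_zero.mpr one_ne_zero))).mul hR h1
      simp_rw [Multiset.map_cons, Multiset.prod_cons, Finset.prod_mul_distrib,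
        prod_primitiveRoot_mul_sub hn hζ, mul_assoc]
      rw [Multiset.card_cons]
      convert h2 using 1
      omega
  have h1 := key P.roots fun ρ hρ => hroots ρ (Polynomial.isRoot_of_mem_roots hρ)
  rw [← hsplit.natDegree_eq_card_roots] at h1
  have h2 := (nearMonomial_const γ R
    (pow_ne_zero n (Polynomial.leadingCoeff_ne_zero.mpr hP))).mul hR h1
  rw [zero_add] at h2
  convert h2 using 2 with w
  simp_rw [hsplit.eval_eq_prod_roots, Finset.prod_mul_distrib]
  simp

/-! ### Evaluation, rescaling and the symmetry of the cyclic resultant -/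

variable {r : ℕ}

/-- Exhibits evaluation as an algebra homomorphism, so that it commutes with products;
`rescale_eq_lift` plays the same role for rescaling. -/
theorem eval_eq_lift (f : Laurent r) (z : Fin r → ℂˣ) :
    eval f z = AddMonoidAlgebra.lift ℂ ℂ (Fin r → ℤ)
      { toFun := fun j => ∏ i, (z i : ℂ) ^ (Multiplicative.toAdd j i)
        map_one' := by simp
        map_mul' := fun x y => by
          simp [zpow_add₀, Finset.prod_mul_distrib] } f := by
  rw [AddMonoidAlgebra.lift_apply]
  simp [eval]

theorem rescale_eq_lift (u : Fin r → ℂˣ) (f : Laurent r) :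
    rescale u f = AddMonoidAlgebra.lift ℂ (Laurent r) (Fin r → ℤ)
      { toFun := fun j => AddMonoidAlgebra.single (Multiplicative.toAdd j)
          (∏ i, (u i : ℂ) ^ (Multiplicative.toAdd j i))
        map_one' := by simp [AddMonoidAlgebra.one_def]
        map_mul' := fun x y => by
          simp [zpow_add₀, Finset.prod_mul_distrib, AddMonoidAlgebra.single_mul_single] } f := by
  rw [AddMonoidAlgebra.lift_apply]
  simp [rescale]

theorem eval_prod {ι : Type*} (s : Finset ι) (g : ι → Laurent r) (z : Fin r → ℂˣ) :
    eval (∏ k ∈ s, g k) z = ∏ k ∈ s, eval (g k) z := by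
  simp_rw [eval_eq_lift, map_prod]

theorem rescale_prod {ι : Type*} (s : Finset ι) (g : ι → Laurent r) (u : Fin r → ℂˣ) :
    rescale u (∏ k ∈ s, g k) = ∏ k ∈ s, rescale u (g k) := by
  simp_rw [rescale_eq_lift, map_prod]

theorem coeff_rescale (u : Fin r → ℂˣ) (f : Laurent r) (j : Fin r → ℤ) :
    (rescale u f).coeff j = f.coeff j * ∏ i, (u i : ℂ) ^ j i := by
  rw [rescale, AddMonoidAlgebra.coeff_finsuppSum, Finsupp.sum_apply]
  simp_rw [AddMonoidAlgebra.coeff_single, Finsupp.single_apply]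
  rw [Finsupp.sum, Finset.sum_ite_eq']
  split_ifs with h
  · rfl
  · rw [Finsupp.notMem_support_iff.mp h, zero_mul]

theorem prod_zpow_ne_zero (u : Fin r → ℂˣ) (j : Fin r → ℤ) : ∏ i, (u i : ℂ) ^ j i ≠ 0 :=
  Finset.prod_ne_zero_iff.mpr fun i _ => zpow_ne_zero _ (u i).ne_zero

theorem support_rescale (u : Fin r → ℂˣ) (f : Laurent r) :
    (rescale u f).coeff.support = f.coeff.support := by
  ext j
  simp [coeff_rescale, prod_zpow_ne_zero]

theorem rescale_rescale (u v : Fin r → ℂˣ) (f : Laurent r) :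
    rescale u (rescale v f) = rescale (u * v) f := by
  ext j
  simp only [coeff_rescale, Pi.mul_apply, Units.val_mul, mul_zpow, Finset.prod_mul_distrib]
  ring

theorem eval_rescale (u : Fin r → ℂˣ) (f : Laurent r) (z : Fin r → ℂˣ) :
    eval (rescale u f) z = eval f (u * z) := by
  unfold eval
  rw [Finsupp.sum, support_rescale, Finsupp.sum]
  refine Finset.sum_congr rfl fun j _ => ?_
  simp only [coeff_rescale, Pi.mul_apply, Units.val_mul, mul_zpow, Finset.prod_mul_distrib]
  ring

theorem eval_cyclicResultant (n : ℕ) (f : Laurent r) (z : Fin r → ℂˣ) :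
    eval (cyclicResultant n f) z =
      ∏ k : Fin r → Fin n, eval f ((fun i => rootOfUnity n (k i)) * z) := by
  rw [cyclicResultant, eval_prod]
  simp_rw [eval_rescale]

theorem rootOfUnity_eq_pow (n k : ℕ) : rootOfUnity n k = rootOfUnity n 1 ^ k := by
  ext
  simp only [rootOfUnity, Units.val_mk0, Units.val_pow_eq_pow_val, ← Complex.exp_nat_mul]
  congr 1
  push_cast
  ring

theorem isPrimitiveRoot_rootOfUnity {n : ℕ} (hn : n ≠ 0) :
    IsPrimitiveRoot ((rootOfUnity n 1 : ℂˣ) : ℂ) n := by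
  have := Complex.isPrimitiveRoot_exp n hn
  simpa [rootOfUnity] using this

theorem norm_rootOfUnity (n k : ℕ) : ‖((rootOfUnity n k : ℂˣ) : ℂ)‖ = 1 := by
  have : (2 * Real.pi * Complex.I * k / n : ℂ) = ((2 * Real.pi * k / n : ℝ) : ℂ) * Complex.I := by
    push_cast
    ring
  rw [rootOfUnity, Units.val_mk0, this, Complex.norm_exp_ofReal_mul_I]

theorem rootOfUnity_zero (n : ℕ) : rootOfUnity n 0 = 1 := by
  rw [rootOfUnity_eq_pow, pow_zero]

theorem rootOfUnity_fin_add_one {n : ℕ} [NeZero n] (k : Fin n) :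
    rootOfUnity n ((k + 1 : Fin n) : ℕ) = rootOfUnity n 1 * rootOfUnity n k := by
  have h1 : rootOfUnity n 1 ^ n = 1 := by
    ext
    rw [Units.val_pow_eq_pow_val, (isPrimitiveRoot_rootOfUnity (NeZero.ne n)).pow_eq_one,
      Units.val_one]
  rw [rootOfUnity_eq_pow n k, ← pow_succ', rootOfUnity_eq_pow, Fin.val_add, ← pow_eq_pow_mod _ h1,
    pow_add, pow_succ, Fin.val_one', ← pow_eq_pow_mod _ h1, pow_one]

/-- The cyclic resultant is invariant under rotating one variable by an `n`-th root of unity. -/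
theorem rescale_cyclicResultant {n : ℕ} (hn : n ≠ 0) (f : Laurent r) (i : Fin r) :
    rescale (Pi.mulSingle i (rootOfUnity n 1)) (cyclicResultant n f) = cyclicResultant n f := by
  have : NeZero n := ⟨hn⟩
  rw [cyclicResultant, rescale_prod]
  refine Fintype.prod_equiv (Equiv.addRight (Pi.single i (1 : Fin n))) _ _ fun k => ?_
  rw [rescale_rescale]
  congr 1
  funext l
  by_cases hl : l = i
  · subst hl
    simp [rootOfUnity_fin_add_one]
  · simp [Pi.mulSingle_eq_of_ne hl, Pi.single_eq_of_ne hl]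

/-- Rotating the `i`-th variable multiplies the coefficient at `q` by `ζ^(q i)` and leaves the
resultant unchanged, so `ζ^(q i) = 1` wherever that coefficient is nonzero. -/
theorem dvd_of_mem_support_cyclicResultant {n : ℕ} (hn : n ≠ 0) (f : Laurent r)
    {q : Fin r → ℤ} (hq : q ∈ (cyclicResultant n f).coeff.support) (i : Fin r) :
    (n : ℤ) ∣ q i := by
  have h := coeff_rescale (Pi.mulSingle i (rootOfUnity n 1)) (cyclicResultant n f) q
  rw [rescale_cyclicResultant hn] at h
  have h1 : ∏ l, ((Pi.mulSingle i (rootOfUnity n 1) : Fin r → ℂˣ) l : ℂ) ^ q l = 1 :=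
    mul_left_cancel₀ (Finsupp.mem_support_iff.mp hq) (by rw [← h, mul_one])
  rw [Finset.prod_eq_single i (fun l _ hl => by simp [Pi.mulSingle_eq_of_ne hl])
    (by simp), Pi.mulSingle_eq_same] at h1
  exact ((isPrimitiveRoot_rootOfUnity hn).zpow_eq_one_iff_dvd _).mp h1

/-! ### Newton polytopes and the number of terms -/

/-- The inclusion of `ℤ^r` in `ℝ^r`. -/
def latticeCast (j : Fin r → ℤ) : Fin r → ℝ := fun i => (j i : ℝ)

theorem latticeCast_mem_newtonPolytope {f : Laurent r} {j : Fin r → ℤ}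
    (hj : j ∈ f.coeff.support) : latticeCast j ∈ newtonPolytope f :=
  subset_convexHull ℝ _ ⟨j, hj, rfl⟩

theorem newtonPolytope_nonempty {f : Laurent r} (hf : f ≠ 0) : (newtonPolytope f).Nonempty := by
  obtain ⟨j, hj⟩ := Finsupp.support_nonempty_iff.mpr
    (fun h => hf (AddMonoidAlgebra.coeff_eq_zero.mp h))
  exact ⟨_, latticeCast_mem_newtonPolytope hj⟩

/-- Exponents add under multiplication, and convexity gives `Δ + kΔ = (k+1)Δ`. -/
theorem latticeCast_mem_smul_of_mem_support_prod {f : Laurent r} (hf : f ≠ 0) {ι : Type*}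
    (s : Finset ι) (g : ι → Laurent r)
    (hg : ∀ k ∈ s, (g k).coeff.support ⊆ f.coeff.support) {q : Fin r → ℤ}
    (hq : q ∈ (∏ k ∈ s, g k).coeff.support) :
    latticeCast q ∈ (s.card : ℝ) • newtonPolytope f := by
  classical
  induction s using Finset.induction_on generalizing q with
  | empty =>
    rw [Finset.prod_empty, AddMonoidAlgebra.one_def, AddMonoidAlgebra.coeff_single] at hq
    have := Finsupp.support_single_subset hq
    rw [Finset.mem_singleton] at this
    subst this
    rw [Finset.card_empty, Nat.cast_zero, Set.zero_smul_set (newtonPolytope_nonempty hf)]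
    ext i
    simp [latticeCast]
  | insert k s hks ih =>
    rw [Finset.prod_insert hks] at hq
    obtain ⟨x, hx, y, hy, rfl⟩ := Finset.mem_add.mp (AddMonoidAlgebra.support_coeff_mul_subset _ _ hq)
    have hconv : Convex ℝ (newtonPolytope f) := convex_convexHull ℝ _
    rw [Finset.card_insert_of_notMem hks, Nat.cast_add, Nat.cast_one, add_comm,
      hconv.add_smul zero_le_one (Nat.cast_nonneg _), one_smul]
    refine ⟨latticeCast x, latticeCast_mem_newtonPolytope (hg k (by simp) hx), latticeCast y,
      ih (fun l hl => hg l (Finset.mem_insert_of_mem hl)) hy, ?_⟩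
    ext i
    simp [latticeCast]

theorem latticeCast_mem_smul_of_mem_support_cyclicResultant {f : Laurent r} (hf : f ≠ 0) (n : ℕ)
    {q : Fin r → ℤ} (hq : q ∈ (cyclicResultant n f).coeff.support) :
    latticeCast q ∈ ((n : ℝ) ^ r) • newtonPolytope f := by
  have := latticeCast_mem_smul_of_mem_support_prod hf _ _
    (fun k _ => (support_rescale _ f).subset) hq
  simpa using this

theorem exists_abs_le_of_mem_newtonPolytope (f : Laurent r) :
    ∃ B : ℕ, ∀ x ∈ newtonPolytope f, ∀ i, |x i| ≤ B := by
  refine ⟨∑ j ∈ f.coeff.support, ∑ i, (j i).natAbs, fun x hx => ?_⟩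
  set B := ∑ j ∈ f.coeff.support, ∑ i, (j i).natAbs with hB
  have hsub : newtonPolytope f ⊆ Set.univ.pi fun _ => Set.Icc (-(B : ℝ)) B := by
    refine convexHull_min ?_ (convex_pi fun _ _ => convex_Icc _ _)
    rintro _ ⟨j, hj, rfl⟩ i _
    have h1 : (j i).natAbs ≤ B :=
      (Finset.single_le_sum (f := fun i => (j i).natAbs) (fun _ _ => Nat.zero_le _)
        (Finset.mem_univ i)).trans
      (Finset.single_le_sum (f := fun j : Fin r → ℤ => ∑ i, (j i).natAbs)
        (fun _ _ => Nat.zero_le _) hj)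
    have h2 : |j i| ≤ (B : ℤ) := by rw [Int.abs_eq_natAbs]; exact_mod_cast h1
    have h3 : |(j i : ℝ)| ≤ B := by exact_mod_cast h2
    exact ⟨(abs_le.mp h3).1, (abs_le.mp h3).2⟩
  exact fun i => abs_le.mpr (hsub hx i (Set.mem_univ i))

theorem latticePoints_subset {f : Laurent r} {B : ℕ}
    (hB : ∀ x ∈ newtonPolytope f, ∀ i, |x i| ≤ B) (m : ℕ) :
    {p : Fin r → ℤ | latticeCast p ∈ (m : ℝ) • newtonPolytope f} ⊆
      (Fintype.piFinset fun _ => Finset.Icc (-(m * B : ℤ)) (m * B) : Finset (Fin r → ℤ)) := by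
  rintro p ⟨x, hx, hxp⟩
  rw [Finset.mem_coe, Fintype.mem_piFinset]
  intro i
  have h1 : (p i : ℝ) = m * x i := (congrFun hxp i).symm
  have h2 : |(p i : ℝ)| ≤ m * B := by
    rw [h1, abs_mul, Nat.abs_cast]
    exact mul_le_mul_of_nonneg_left (hB x hx i) (Nat.cast_nonneg m)
  have h3 : |p i| ≤ (m * B : ℤ) := by exact_mod_cast h2
  exact Finset.mem_Icc.mpr (abs_le.mp h3)

theorem finite_latticePoints (f : Laurent r) (m : ℕ) :
    {p : Fin r → ℤ | latticeCast p ∈ (m : ℝ) • newtonPolytope f}.Finite := by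
  obtain ⟨B, hB⟩ := exists_abs_le_of_mem_newtonPolytope f
  exact (Finset.finite_toSet _).subset (latticePoints_subset hB m)

/-- A crude box count: `mΔ` has coordinates bounded by `mB`, and `2mB + 1 ≤ m(2B + 1)`. Some `d` is
all that convergence requires. -/
theorem exists_isLatticePointBound (f : Laurent r) :
    ∃ d, IsLatticePointBound (newtonPolytope f) d := by
  obtain ⟨B, hB⟩ := exists_abs_le_of_mem_newtonPolytope f
  refine ⟨(2 * B + 1) ^ r, fun m hm => ?_⟩
  have hm' : (1 : ℝ) ≤ m := by exact_mod_cast hm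
  rw [div_le_iff₀ (by positivity), ← mul_pow]
  have h1 := Set.ncard_le_ncard (latticePoints_subset hB m) (Finset.finite_toSet _)
  rw [Set.ncard_coe_finset, Fintype.card_piFinset] at h1
  simp only [Int.card_Icc, Finset.prod_const, Finset.card_univ, Fintype.card_fin] at h1
  have h2 : ((m * B + 1 - -(m * B : ℤ)).toNat) = 2 * (m * B) + 1 := by
    have : (m * B : ℤ) = ((m * B : ℕ) : ℤ) := by push_cast; rfl
    rw [this]
    omega
  rw [h2] at h1
  have h3 : (({p : Fin r → ℤ | latticeCast p ∈ (m : ℝ) • newtonPolytope f}.ncard : ℕ) : ℝ) ≤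
      (2 * (m * B) + 1) ^ r := by exact_mod_cast h1
  refine h3.trans (pow_le_pow_left₀ (by positivity) ?_ r)
  nlinarith

/-- Dividing exponents by `n` is injective on the support and maps it into the lattice points of
`n^(r-1) Δ`. -/
theorem card_support_cyclicResultant_le {f : Laurent r} (hf : f ≠ 0) (hr : r ≠ 0) {n : ℕ}
    (hn : n ≠ 0) {d : ℝ} (hd : IsLatticePointBound (newtonPolytope f) d) :
    ((cyclicResultant n f).coeff.support.card : ℝ) ≤ d * ((n : ℝ) ^ (r - 1)) ^ r := by
  have hnR : (n : ℝ) ≠ 0 := by exact_mod_cast hn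
  have h1 := hd (n ^ (r - 1)) (Nat.one_le_pow _ _ (Nat.pos_of_ne_zero hn))
  rw [div_le_iff₀ (by positivity)] at h1
  rw [Nat.cast_pow] at h1
  refine le_trans ?_ h1
  have hfin := finite_latticePoints f (n ^ (r - 1))
  rw [Nat.cast_pow] at hfin
  rw [← Set.ncard_coe_finset]
  refine Nat.cast_le.mpr ?_
  refine Set.ncard_le_ncard_of_injOn (fun (q : Fin r → ℤ) i => q i / (n : ℤ)) ?_ ?_ ?_
  · intro q hq
    obtain ⟨x, hx, hxq⟩ := latticeCast_mem_smul_of_mem_support_cyclicResultant hf n hq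
    refine ⟨x, hx, ?_⟩
    funext i
    have h2 : (n : ℝ) ^ r * x i = q i := congrFun hxq i
    have h3 : ((q i / n : ℤ) : ℝ) = q i / n := by
      rw [Int.cast_div (dvd_of_mem_support_cyclicResultant hn f hq i) (by exact_mod_cast hn)]
      simp
    obtain ⟨t, rfl⟩ := Nat.exists_eq_succ_of_ne_zero hr
    simp only [Pi.smul_apply, smul_eq_mul, h3, Nat.succ_eq_add_one, Nat.add_sub_cancel, ← h2]
    field_simp
    ring
  · intro q hq q' hq' h
    funext i
    have h2 := congrFun h i
    simp only at h2
    rw [← Int.ediv_mul_cancel (dvd_of_mem_support_cyclicResultant hn f hq i), h2,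
      Int.ediv_mul_cancel (dvd_of_mem_support_cyclicResultant hn f hq' i)]
  · exact hfin

/-- Here `Δ` is a point, hence so is `n^r Δ`. -/
theorem card_support_cyclicResultant_le_one {f : Laurent r} (hf : f ≠ 0)
    (h : f.coeff.support.card ≤ 1) (n : ℕ) :
    (cyclicResultant n f).coeff.support.card ≤ 1 := by
  have hsub : (newtonPolytope f).Subsingleton := by
    refine Set.Subsingleton.anti (t := convexHull ℝ _) ?_ subset_rfl
    have : ((fun (j : Fin r → ℤ) (i : Fin r) => (j i : ℝ)) ''
        (f.coeff.support : Set (Fin r → ℤ))).Subsingleton := by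
      refine Set.Subsingleton.image (fun a ha b hb => ?_) _
      exact Finset.card_le_one.mp h a ha b hb
    rcases this.eq_empty_or_singleton with h | ⟨x, h⟩ <;> simp [h]
  rw [Finset.card_le_one]
  intro a ha b hb
  obtain ⟨x, hx, hxa⟩ := latticeCast_mem_smul_of_mem_support_cyclicResultant hf n ha
  obtain ⟨y, hy, hyb⟩ := latticeCast_mem_smul_of_mem_support_cyclicResultant hf n hb
  rw [hsub hx hy] at hxa
  have := hxa.symm.trans hyb
  funext i
  exact Int.cast_injective (α := ℝ) (congrFun this i)

theorem sub_le_width {f : Laurent r} (i : Fin r) {j j' : Fin r → ℤ} (hj : j ∈ f.coeff.support)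
    (hj' : j' ∈ f.coeff.support) : (j i : ℝ) - j' i ≤ width f := by
  obtain ⟨B, hB⟩ := exists_abs_le_of_mem_newtonPolytope f
  have h1 : (j i : ℝ) ≤ sSup ((fun x => x i) '' newtonPolytope f) := by
    refine le_csSup ⟨B, ?_⟩ ⟨_, latticeCast_mem_newtonPolytope hj, rfl⟩
    rintro _ ⟨x, hx, rfl⟩
    exact (abs_le.mp (hB x hx i)).2
  have h2 : sInf ((fun x => x i) '' newtonPolytope f) ≤ (j' i : ℝ) := by
    refine csInf_le ⟨-B, ?_⟩ ⟨_, latticeCast_mem_newtonPolytope hj', rfl⟩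
    rintro _ ⟨x, hx, rfl⟩
    exact (abs_le.mp (hB x hx i)).1
  refine le_trans (sub_le_sub h1 h2) ?_
  exact le_ciSup (f := fun i : Fin r => sSup ((fun x => x i) '' newtonPolytope f) -
    sInf ((fun x => x i) '' newtonPolytope f)) (Set.finite_range _).bddAbove i

/-! ### One-variable restrictions far from the amoeba -/

/-- As a function of one variable, a Laurent polynomial is a monomial times a polynomial. -/
theorem exists_polynomial_eval_update {f : Laurent r} (hf : f ≠ 0) (i : Fin r)
    (y : Fin r → ℂˣ) :
    ∃ P : Polynomial ℂ, P.natDegree ≤ ⌊width f⌋₊ ∧ ∃ m : ℤ, ∀ w : ℂˣ,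
      eval f (Function.update y i w) = (w : ℂ) ^ m * P.eval (w : ℂ) := by
  have hne : f.coeff.support.Nonempty := Finsupp.support_nonempty_iff.mpr
    (fun h => hf (AddMonoidAlgebra.coeff_eq_zero.mp h))
  obtain ⟨j₀, hj₀, hmin⟩ := Finset.exists_min_image f.coeff.support (fun j => j i) hne
  refine ⟨∑ j ∈ f.coeff.support, Polynomial.monomial (j i - j₀ i).toNat
    (f.coeff j * ∏ l ∈ Finset.univ.erase i, (y l : ℂ) ^ j l), ?_, j₀ i, fun w => ?_⟩
  · refine Polynomial.natDegree_sum_le_of_forall_le _ _ fun j hj => ?_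
    refine (Polynomial.natDegree_monomial_le _).trans (Nat.le_floor ?_)
    have h0 := hmin j hj
    have h1 : (((j i - j₀ i).toNat : ℤ) : ℝ) = (j i : ℝ) - j₀ i := by
      rw [Int.toNat_of_nonneg (by omega)]
      push_cast
      rfl
    rw [Int.cast_natCast] at h1
    rw [h1]
    exact sub_le_width i hj hj₀
  · rw [Polynomial.eval_finsetSum, Finset.mul_sum, eval, Finsupp.sum]
    refine Finset.sum_congr rfl fun j hj => ?_
    have h0 := hmin j hj
    rw [Polynomial.eval_monomial, ← Finset.mul_prod_erase _ _ (Finset.mem_univ i)]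
    have h1 : ∏ l ∈ Finset.univ.erase i, ((Function.update y i w l : ℂˣ) : ℂ) ^ j l =
        ∏ l ∈ Finset.univ.erase i, (y l : ℂ) ^ j l :=
      Finset.prod_congr rfl fun l hl => by
        rw [Function.update_of_ne (Finset.ne_of_mem_erase hl)]
    have h2 : (w : ℂ) ^ j i = (w : ℂ) ^ j₀ i * (w : ℂ) ^ (j i - j₀ i).toNat := by
      rw [← zpow_natCast, ← zpow_add₀ w.ne_zero, Int.toNat_of_nonneg (by omega)]
      congr 1
      ring
    rw [h1, Function.update_self, h2]
    ring

/-- A zero of `f` on the torus over `a` moved in the `i`-th coordinate only. -/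
theorem le_abs_log_sub_of_eval_eq_zero {f : Laurent r} {a : EuclideanSpace ℝ (Fin r)} {ε : ℝ}
    (ha : ∀ b ∈ amoeba f, ε ≤ dist a b) (i : Fin r) (y : Fin r → ℂˣ)
    (hy : ∀ l, l ≠ i → ‖(y l : ℂ)‖ = Real.exp (a l)) (w : ℂˣ)
    (hw : eval f (Function.update y i w) = 0) : ε ≤ |Real.log ‖(w : ℂ)‖ - a i| := by
  refine (ha _ ⟨_, hw, rfl⟩).trans_eq ?_
  rw [EuclideanSpace.dist_eq, Finset.sum_eq_single i]
  · rw [Real.sqrt_sq dist_nonneg, Real.dist_eq, abs_sub_comm]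
    simp [logMap]
  · intro l _ hl
    simp [logMap, Function.update_of_ne hl, hy l hl]
  · simp

theorem pow_le_exp_mul_pow {x : ℝ} (hx : 0 < x) {s ε : ℝ} (n : ℕ)
    (h : ε ≤ |Real.log x - s|) :
    x ^ n ≤ Real.exp (-(n * ε)) * Real.exp s ^ n ∨
      Real.exp s ^ n ≤ Real.exp (-(n * ε)) * x ^ n := by
  have hn : (0 : ℝ) ≤ n := Nat.cast_nonneg n
  have hxn : x ^ n = Real.exp (n * Real.log x) := by rw [Real.exp_nat_mul, Real.exp_log hx]
  rw [hxn, ← Real.exp_nat_mul, ← Real.exp_add, ← Real.exp_add, Real.exp_le_exp, Real.exp_le_exp]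
  rcases le_abs.mp h with h | h
  · right; nlinarith
  · left; nlinarith

theorem exists_nearMonomial_prod_eval_update {f : Laurent r} (hf : f ≠ 0)
    {a : EuclideanSpace ℝ (Fin r)} {ε : ℝ} (hε : 0 < ε) (ha : ∀ b ∈ amoeba f, ε ≤ dist a b)
    {n : ℕ} (hn : n ≠ 0) (i : Fin r) (y : Fin r → ℂˣ)
    (hy : ∀ l, l ≠ i → ‖(y l : ℂ)‖ = Real.exp (a l)) :
    ∃ g, NearMonomial (Real.exp (-(n * ε))) ⌊width f⌋₊ (Real.exp (a i)) g ∧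
      ∀ w : ℂˣ, ∏ k : Fin n, eval f (Function.update y i (rootOfUnity n k * w)) = g w := by
  obtain ⟨P, hPdeg, m, hP⟩ := exists_polynomial_eval_update hf i y
  have hR := Real.exp_pos (a i)
  have hζ := isPrimitiveRoot_rootOfUnity hn
  -- If `P = 0`, then `w = e^(a i)` is a zero too, at distance `0` in the `i`-th coordinate,
  -- contradicting `ε > 0`.
  have hP0 : P ≠ 0 := by
    rintro rfl
    have h := le_abs_log_sub_of_eval_eq_zero ha i y hy
      (Units.mk0 ((Real.exp (a i) : ℝ) : ℂ) (by exact_mod_cast hR.ne')) (by simp [hP])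
    rw [Units.val_mk0, Complex.norm_real, Real.norm_of_nonneg hR.le, Real.log_exp, sub_self,
      abs_zero] at h
    linarith
  have h1 := nearMonomial_prod_eval (γ := Real.exp (-(n * ε))) hR (Nat.pos_of_ne_zero hn) hζ P hP0
    (fun ρ hρ => by
      -- The root `0` gives no point of the torus, but the first alternative holds for it trivially.
      by_cases h0 : ρ = 0
      · left
        rw [h0, norm_zero, zero_pow hn]
        positivity
      · refine pow_le_exp_mul_pow (norm_pos_iff.mpr h0) n ?_
        refine le_abs_log_sub_of_eval_eq_zero ha i y hy (Units.mk0 ρ h0) ?_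
        rw [hP, Units.val_mk0, hρ.eq_zero, mul_zero])
  -- The contribution of the factor `w^m` over all `n` rotations of `w`.
  have h2 := nearMonomial_const_mul_zpow (Real.exp (-(n * ε))) (Real.exp (a i))
    (C := ∏ k : Fin n, (((rootOfUnity n 1 : ℂˣ) : ℂ) ^ (k : ℕ)) ^ m)
    (Finset.prod_ne_zero_iff.mpr fun k _ =>
      zpow_ne_zero _ (pow_ne_zero _ (Units.ne_zero _))) (m * n)
  refine ⟨_, ((h2.mul hR h1).mono (Real.exp_pos _).le (by simpa using hPdeg)), fun w => ?_⟩
  have hpow : ∀ k : Fin n, rootOfUnity n (k : ℕ) = rootOfUnity n 1 ^ (k : ℕ) :=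
    fun k => rootOfUnity_eq_pow n k
  simp_rw [hP, Finset.prod_mul_distrib, hpow, Units.val_mul,
    Units.val_pow_eq_pow_val, mul_zpow, Finset.prod_mul_distrib]
  simp [zpow_mul]

/-- If `a` is far from the amoeba of `f`, then on the torus over `a` the cyclic resultant is
close to a monomial in each variable. -/
theorem exists_nearMonomial_eval_cyclicResultant {f : Laurent r} (hf : f ≠ 0)
    {a : EuclideanSpace ℝ (Fin r)} {ε : ℝ} (hε : 0 < ε) (ha : ∀ b ∈ amoeba f, ε ≤ dist a b)
    {n : ℕ} (hn : n ≠ 0) (i : Fin r) (z : Fin r → ℂˣ)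
    (hz : ∀ l, l ≠ i → ‖(z l : ℂ)‖ = Real.exp (a l)) :
    ∃ g, NearMonomial (Real.exp (-(n * ε))) (n ^ (r - 1) * ⌊width f⌋₊) (Real.exp (a i)) g ∧
      ∀ w : ℂˣ, eval (cyclicResultant n f) (Function.update z i w) = g w := by
  let y : ({l // l ≠ i} → Fin n) → Fin r → ℂˣ := fun k l =>
    if h : l ≠ i then rootOfUnity n (k ⟨l, h⟩) * z l else 1
  have hy : ∀ k l, l ≠ i → ‖(y k l : ℂ)‖ = Real.exp (a l) := fun k l hl => by
    simp only [y, dif_pos hl, Units.val_mul, norm_mul, norm_rootOfUnity, one_mul, hz l hl]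
  choose g hg hgw using fun k => exists_nearMonomial_prod_eval_update hf hε ha hn i (y k) (hy k)
  refine ⟨fun w => ∏ k, g k w, ?_, fun w => ?_⟩
  rotate_left
  · rw [eval_cyclicResultant, ← Equiv.prod_comp (Equiv.funSplitAt i (Fin n)).symm,
      Fintype.prod_prod_type_right]
    simp only [← hgw]
    refine Finset.prod_congr rfl fun k _ => Finset.prod_congr rfl fun k' _ => ?_
    congr 1
    funext l
    by_cases hl : l = i
    · subst hl
      simp
    · simp [y, hl]
  · have := NearMonomial.prod (Real.exp_pos (a i)) Finset.univ g fun k _ => hg k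
    convert this using 2
    simp [Fintype.card_subtype_compl]

/-! ### Superlopsidedness away from the amoeba -/

/-- The point of the torus over `a` with arguments `θ`. -/
noncomputable def torusPoint (a : EuclideanSpace ℝ (Fin r)) (θ : Fin r → ℝ) : Fin r → ℂˣ :=
  fun l => Units.mk0 (Complex.exp (a l + Complex.I * θ l)) (Complex.exp_ne_zero _)

theorem norm_torusPoint (a : EuclideanSpace ℝ (Fin r)) (θ : Fin r → ℝ) (l : Fin r) :
    ‖(torusPoint a θ l : ℂ)‖ = Real.exp (a l) := by
  rw [torusPoint, Units.val_mk0, Complex.norm_exp]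
  simp

theorem logMap_torusPoint (a : EuclideanSpace ℝ (Fin r)) (θ : Fin r → ℝ) :
    logMap (torusPoint a θ) = a := by
  ext l
  simp [logMap, norm_torusPoint]

theorem eval_torusPoint (g : Laurent r) (a : EuclideanSpace ℝ (Fin r)) (θ : Fin r → ℝ) :
    eval g (torusPoint a θ) =
      trigPoly g.coeff.support (fun q => g.coeff q * ∏ l, Complex.exp (a l) ^ q l) θ := by
  rw [eval, Finsupp.sum, trigPoly]
  refine Finset.sum_congr rfl fun q _ => ?_
  rw [mul_assoc, Finset.mul_sum, Complex.exp_sum, ← Finset.prod_mul_distrib]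
  congr 1
  refine Finset.prod_congr rfl fun l _ => ?_
  rw [torusPoint, Units.val_mk0, Complex.exp_add, mul_zpow, ← Complex.exp_int_mul]
  rw [← Complex.exp_int_mul]
  congr 2
  ring

theorem norm_coeff_mul_prod_exp (g : Laurent r) (a : EuclideanSpace ℝ (Fin r))
    (q : Fin r → ℤ) :
    ‖g.coeff q * ∏ l, Complex.exp (a l) ^ q l‖ = monomialAbs g a q := by
  rw [norm_mul, norm_prod, monomialAbs]
  simp [Complex.norm_exp]

theorem monomialAbs_pos {g : Laurent r} (a : EuclideanSpace ℝ (Fin r)) {q : Fin r → ℤ}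
    (hq : q ∈ g.coeff.support) : 0 < monomialAbs g a q :=
  mul_pos (norm_pos_iff.mpr (Finsupp.mem_support_iff.mp hq))
    (Finset.prod_pos fun _ _ => zpow_pos (Real.exp_pos _) _)

theorem torusPoint_add_single (a : EuclideanSpace ℝ (Fin r)) (θ : Fin r → ℝ) (i : Fin r)
    (s : ℝ) : torusPoint a (θ + Pi.single i s) = Function.update (torusPoint a θ) i
      (torusPoint a θ i * Units.mk0 (Complex.exp (Complex.I * s)) (Complex.exp_ne_zero _)) := by
  funext l
  by_cases hl : l = i
  · subst hl
    ext
    simp only [torusPoint, Pi.add_apply, Pi.single_eq_same, Function.update_self, Units.val_mul,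
      Units.val_mk0, ← Complex.exp_add]
    congr 1
    push_cast
    ring
  · rw [Function.update_of_ne hl]
    simp [torusPoint, Pi.single_eq_of_ne hl]

theorem superlopsided_cyclicResultant {f : Laurent r} (hf : f ≠ 0)
    {a : EuclideanSpace ℝ (Fin r)} {ε : ℝ} (hε : 0 < ε) (ha : ∀ b ∈ amoeba f, ε ≤ dist a b)
    {n : ℕ} (hn : n ≠ 0) (D : ℕ) (hD : 1 ≤ D)
    (hcard : (cyclicResultant n f).coeff.support.card = D + 1)
    (hδ : (2 * D + 1) * ((1 + Real.exp (-(n * ε))) ^ (n ^ (r - 1) * ⌊width f⌋₊) - 1) < 1) :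
    Superlopsided (cyclicResultant n f).coeff.support (monomialAbs (cyclicResultant n f) a) := by
  obtain ⟨p, hp, hdom⟩ := exists_dominant_coeff (cyclicResultant n f).coeff.support
    (fun q => (cyclicResultant n f).coeff q * ∏ l, Complex.exp (a l) ^ q l)
    (fun q hq => by
      rw [← norm_pos_iff, norm_coeff_mul_prod_exp]
      exact monomialAbs_pos a hq) D hD hcard _
    (sub_nonneg.mpr (one_le_pow₀ (by linarith [Real.exp_pos (-(n * ε))]))) hδ
    (fun i θ => by
      obtain ⟨g, ⟨C, hC, p, hg⟩, hgw⟩ := exists_nearMonomial_eval_cyclicResultant hf hε ha hn i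
        (torusPoint a θ) fun l _ => norm_torusPoint a θ l
      -- Writing `w = z_i e^(is)`, the monomial `C w^p` becomes `C z_i^p e^(ips)`.
      refine ⟨C * (torusPoint a θ i : ℂ) ^ p,
        mul_ne_zero hC (zpow_ne_zero _ (Units.ne_zero _)), p, fun s => ?_⟩
      have hs : ‖Complex.exp (Complex.I * s)‖ = 1 := by
        rw [mul_comm, Complex.norm_exp_ofReal_mul_I]
      obtain ⟨u, hu, hgu⟩ := hg
        ((torusPoint a θ i * Units.mk0 (Complex.exp (Complex.I * s)) (Complex.exp_ne_zero _) :
          ℂˣ) : ℂ) (by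
          rw [Units.val_mul, norm_mul, norm_torusPoint, Units.val_mk0, hs, mul_one])
      rw [← eval_torusPoint, torusPoint_add_single, hgw, hgu, Units.val_mul, Units.val_mk0,
        mul_zpow, ← Complex.exp_int_mul]
      have h1 : C * ((torusPoint a θ i : ℂ) ^ p * Complex.exp (p * (Complex.I * s))) * u -
          C * (torusPoint a θ i : ℂ) ^ p * Complex.exp (Complex.I * p * s) =
          C * (torusPoint a θ i : ℂ) ^ p * Complex.exp (Complex.I * (p * s : ℝ)) * (u - 1) := by
        have : (p : ℂ) * (Complex.I * s) = Complex.I * (p * s : ℝ) := by push_cast; ring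
        have h' : Complex.I * (p : ℂ) * s = Complex.I * (p * s : ℝ) := by push_cast; ring
        rw [this, h']
        ring
      rw [h1, norm_mul, norm_mul, mul_comm Complex.I, Complex.norm_exp_ofReal_mul_I, mul_one,
        mul_comm]
      exact mul_le_mul_of_nonneg_right hu (norm_nonneg _))
  refine ⟨p, hp, fun q hq hqp => ?_⟩
  have := hdom q hq hqp
  rw [norm_coeff_mul_prod_exp, norm_coeff_mul_prod_exp] at this
  rw [hcard]
  push_cast
  rwa [add_sub_cancel_right]

/-! ### Inclusions between the three sets -/

theorem cyclicResultant_ne_zero {f : Laurent r} (hf : f ≠ 0) (n : ℕ) :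
    cyclicResultant n f ≠ 0 := by
  refine Finset.prod_ne_zero_iff.mpr fun k _ h => hf ?_
  rw [← AddMonoidAlgebra.coeff_eq_zero, ← Finsupp.support_eq_empty] at h ⊢
  rwa [support_rescale] at h

/-- Sum the defining inequalities over the other entries and divide by their number; positivity
settles a one-entry list. -/
theorem Superlopsided.lopsided {ι : Type*} [DecidableEq ι] {s : Finset ι} {b : ι → ℝ}
    (hb : ∀ i ∈ s, 0 < b i) (h : Superlopsided s b) : Lopsided s b := by
  obtain ⟨i, hi, h⟩ := h
  refine ⟨i, hi, ?_⟩
  rcases (s.erase i).eq_empty_or_nonempty with he | hne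
  · rw [he, Finset.sum_empty]
    exact hb i hi
  · have hcard : (0 : ℝ) < (s.erase i).card := by exact_mod_cast Finset.card_pos.mpr hne
    have hc : ((s.erase i).card : ℝ) = s.card - 1 := by
      rw [← Finset.card_erase_add_one hi]
      push_cast
      ring
    have h1 : ∑ j ∈ s.erase i, (s.erase i).card * b j < ∑ _j ∈ s.erase i, b i :=
      Finset.sum_lt_sum_of_nonempty hne fun j hj => by
        rw [hc]
        exact h j (Finset.mem_of_mem_erase hj) (Finset.ne_of_mem_erase hj)
    rw [← Finset.mul_sum, Finset.sum_const, nsmul_eq_mul] at h1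
    exact lt_of_mul_lt_mul_left h1 hcard.le

theorem nonLopsidedSet_subset (g : Laurent r) : nonLopsidedSet g ⊆ nonSuperlopsidedSet g :=
  fun a ha h => ha (h.lopsided fun _ hq => monomialAbs_pos a hq)

theorem monomialAbs_logMap (g : Laurent r) (z : Fin r → ℂˣ) (q : Fin r → ℤ) :
    monomialAbs g (logMap z) q = ‖g.coeff q * ∏ i, (z i : ℂ) ^ q i‖ := by
  rw [monomialAbs, norm_mul, norm_prod]
  congr 1
  refine Finset.prod_congr rfl fun i _ => ?_
  rw [norm_zpow, logMap]
  simp [Real.exp_log]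

/-- At a zero, each monomial is minus the sum of the others, so the triangle inequality excludes
lopsidedness. -/
theorem amoeba_subset_nonLopsidedSet (g : Laurent r) : amoeba g ⊆ nonLopsidedSet g := by
  rintro _ ⟨z, hz, rfl⟩ ⟨i, hi, hlt⟩
  rw [Set.mem_ofPred_eq, eval, Finsupp.sum, ← Finset.add_sum_erase _ _ hi] at hz
  have h1 := norm_sum_le (g.coeff.support.erase i) fun j => g.coeff j * ∏ l, (z l : ℂ) ^ j l
  rw [← norm_neg, ← eq_neg_of_add_eq_zero_left hz] at h1
  simp_rw [monomialAbs_logMap] at hlt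
  exact absurd h1 (not_le.mpr hlt)

theorem amoeba_subset_amoeba_cyclicResultant {n : ℕ} (hn : n ≠ 0) (f : Laurent r) :
    amoeba f ⊆ amoeba (cyclicResultant n f) := by
  have : NeZero n := ⟨hn⟩
  refine Set.image_mono fun z hz => ?_
  rw [Set.mem_ofPred_eq, eval_cyclicResultant]
  refine Finset.prod_eq_zero (Finset.mem_univ 0) ?_
  have h1 : (fun i => rootOfUnity n ((0 : Fin r → Fin n) i)) * z = z := by
    funext i
    simp [rootOfUnity_zero]
  rw [h1]
  exact hz

/-! ### The explicit bound and convergence -/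

theorem exists_mem_amoeba_dist_lt {f : Laurent r} (hf : f ≠ 0) {d : ℝ}
    (hd : IsLatticePointBound (newtonPolytope f) d) {n : ℕ} (hn : 1 ≤ n)
    {a : EuclideanSpace ℝ (Fin r)} (ha : a ∈ nonSuperlopsidedSet (cyclicResultant n f)) :
    ∃ b ∈ amoeba f, dist a b <
      (((r : ℝ) ^ 2 - 1) * Real.log n + Real.log (16 / 3 * width f * d)) / n := by
  set ε := (((r : ℝ) ^ 2 - 1) * Real.log n + Real.log (16 / 3 * width f * d)) / n with hε
  by_contra! hfar
  refine ha ?_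
  have hn0 : n ≠ 0 := by omega
  have hn1 : (1 : ℝ) ≤ n := by exact_mod_cast hn
  have hnpos : (0 : ℝ) < n := by linarith
  obtain ⟨q₀, hq₀⟩ := Finsupp.support_nonempty_iff.mpr
    (fun h => cyclicResultant_ne_zero hf n (AddMonoidAlgebra.coeff_eq_zero.mp h))
  -- A single term is vacuously superlopsided; this disposes of monomial `f`, for which the width is
  -- not positive.
  rcases le_or_gt (cyclicResultant n f).coeff.support.card 1 with hcard | hcard
  · exact ⟨q₀, hq₀, fun j hj hne => absurd (Finset.card_le_one.mp hcard j hj q₀ hq₀) hne⟩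
  obtain ⟨D, hDcard⟩ : ∃ D, (cyclicResultant n f).coeff.support.card = D + 1 :=
    ⟨_, (Nat.sub_add_cancel hcard.le).symm⟩
  have hD : 1 ≤ D := by omega
  have hD1 : (1 : ℝ) ≤ D := by exact_mod_cast hD
  obtain ⟨j, hj, j', hj', hjj'⟩ : ∃ j ∈ f.coeff.support, ∃ j' ∈ f.coeff.support, j ≠ j' := by
    rw [← Finset.one_lt_card]
    by_contra! hle
    exact absurd (card_support_cyclicResultant_le_one hf hle n) (not_le.mpr hcard)
  obtain ⟨i, hi⟩ := Function.ne_iff.mp hjj'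
  have hwidth : 1 ≤ width f := by
    rcases lt_or_gt_of_ne hi with h | h
    · have h1 : (1 : ℝ) ≤ (j' i : ℝ) - j i := by exact_mod_cast (by omega : (1 : ℤ) ≤ j' i - j i)
      exact h1.trans (sub_le_width i hj' hj)
    · have h1 : (1 : ℝ) ≤ (j i : ℝ) - j' i := by exact_mod_cast (by omega : (1 : ℤ) ≤ j i - j' i)
      exact h1.trans (sub_le_width i hj hj')
  obtain ⟨t, rfl⟩ : ∃ t, r = t + 1 := Nat.exists_eq_succ_of_ne_zero (by
    rintro rfl
    exact i.elim0)
  have hQ := card_support_cyclicResultant_le hf (by omega) hn0 hd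
  rw [hDcard, Nat.add_sub_cancel] at hQ
  push_cast at hQ
  set M : ℝ := (n : ℝ) ^ t with hM
  have hM1 : 1 ≤ M := one_le_pow₀ hn1
  set Q : ℝ := d * M ^ (t + 1) with hQdef
  have hdpos : 0 < d := by
    by_contra! h
    have : Q ≤ 0 := mul_nonpos_of_nonpos_of_nonneg h (by positivity)
    linarith
  have hwpos : 0 < width f := by linarith
  -- With `r = t + 1`, the powers of `n` in `M` and `Q` add up to `t + t(t+1) = r² - 1`.
  have hnε : (n : ℝ) * ε = Real.log (16 / 3 * (M * width f) * Q) := by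
    have h1 : 16 / 3 * (M * width f) * Q =
        ((n : ℝ) ^ (t + t * (t + 1))) * (16 / 3 * width f * d) := by
      rw [hQdef, hM, ← pow_mul, pow_add]
      ring
    rw [h1, Real.log_mul (by positivity) (by positivity), Real.log_pow, hε]
    push_cast
    field_simp
    ring
  have hE : 1 < 16 / 3 * (M * width f) * Q := by
    have : 1 ≤ M * width f := one_le_mul_of_one_le_of_one_le hM1 hwidth
    nlinarith
  have hεpos : 0 < ε := by
    have h1 : 0 < (n : ℝ) * ε := hnε ▸ Real.log_pos hE
    exact (mul_pos_iff_of_pos_left hnpos).mp h1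
  refine superlopsided_cyclicResultant hf hεpos hfar hn0 D hD hDcard ?_
  have hγ : Real.exp (-(n * ε)) = (16 / 3 * (M * width f) * Q)⁻¹ := by
    rw [hnε, Real.exp_neg, Real.exp_log (by linarith)]
  set γ := Real.exp (-(n * ε))
  have hγ0 : 0 < γ := Real.exp_pos _
  set L := n ^ (t + 1 - 1) * ⌊width f⌋₊ with hL
  have hLle : (L : ℝ) ≤ M * width f := by
    rw [hL, Nat.add_sub_cancel]
    push_cast
    exact mul_le_mul_of_nonneg_left (Nat.floor_le hwpos.le) (by positivity)
  set x : ℝ := L * γ with hx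
  have hx0 : 0 ≤ x := by positivity
  -- The constant `16/3` is inverted here. Since `D + 1 ≥ 2`, also `x ≤ 3/32`, whence `x + x² ≤
  -- (35/32) x` below.
  have hxQ : (D + 1) * x ≤ 3 / 16 := by
    have hMw : 0 < M * width f := by positivity
    have hQpos : 0 < Q := by linarith
    calc (D + 1) * x ≤ Q * ((M * width f) * γ) := by
          rw [hx]
          gcongr
      _ = 3 / 16 := by
          rw [hγ]
          field_simp
  have hx1 : x ≤ 3 / 32 := by nlinarith
  have h1 : (1 + γ) ^ L ≤ Real.exp x := by
    rw [hx, Real.exp_nat_mul]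
    refine pow_le_pow_left₀ (by positivity) ?_ L
    linarith [Real.add_one_le_exp γ]
  have h2 : Real.exp x - 1 - x ≤ x ^ 2 :=
    (le_abs_self _).trans (Real.abs_exp_sub_one_sub_id_le (by rw [abs_of_nonneg hx0]; linarith))
  have h3 : (1 + γ) ^ L - 1 ≤ 35 / 32 * x := by nlinarith
  -- Bounded by `2 · (35/32) · (3/16) < 1`.
  calc (2 * D + 1) * ((1 + γ) ^ L - 1) ≤ (2 * D + 1) * (35 / 32 * x) := by gcongr
    _ < 1 := by nlinarith

theorem hausdorffEDist_le_ofReal {X : Type*} [PseudoMetricSpace X] {s t : Set X} (hts : t ⊆ s)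
    {ε : ℝ} (h : ∀ x ∈ s, ∃ y ∈ t, dist x y < ε) :
    Metric.hausdorffEDist s t ≤ ENNReal.ofReal ε := by
  refine Metric.hausdorffEDist_le_of_mem_edist (fun x hx => ?_) fun x hx =>
    ⟨x, hts hx, by simp⟩
  obtain ⟨y, hy, hxy⟩ := h x hx
  exact ⟨y, hy, edist_dist x y ▸ ENNReal.ofReal_le_ofReal hxy.le⟩

theorem tendsto_mul_log_add_div (A B : ℝ) :
    Tendsto (fun n : ℕ => (A * Real.log n + B) / n) atTop (𝓝 0) := by
  have h1 : Tendsto (fun n : ℕ => Real.log n / n) atTop (𝓝 0) := by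
    have := (Real.tendsto_pow_log_div_mul_add_atTop 1 0 1 one_ne_zero).comp
      tendsto_natCast_atTop_atTop
    simpa [Function.comp_def] using this
  have h2 := (h1.const_mul A).add (tendsto_const_div_atTop_nhds_zero_nat B)
  rw [mul_zero, add_zero] at h2
  refine h2.congr fun n => ?_
  ring

theorem amoeba_zero : amoeba (0 : Laurent r) = Set.univ :=
  Set.eq_univ_of_forall fun a => ⟨torusPoint a 0, by simp [eval], logMap_torusPoint a 0⟩

/-- Any family of sets between the amoeba and the non-superlopsided sets converges to the
amoeba. -/
theorem tendsto_hausdorffEDist_amoeba (f : Laurent r) (S : ℕ → Set (EuclideanSpace ℝ (Fin r)))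
    (h₁ : ∀ n, 1 ≤ n → amoeba f ⊆ S n)
    (h₂ : ∀ n, 1 ≤ n → S n ⊆ nonSuperlopsidedSet (cyclicResultant n f)) :
    Tendsto (fun n => Metric.hausdorffEDist (S n) (amoeba f)) atTop (𝓝 0) := by
  -- The amoeba is then the whole space, so every distance is `0`.
  by_cases hf : f = 0
  · subst hf
    refine tendsto_const_nhds.congr' ?_
    filter_upwards [eventually_ge_atTop 1] with n hn
    have := h₁ n hn
    rw [amoeba_zero, Set.univ_subset_iff] at this
    rw [amoeba_zero, this, Metric.hausdorffEDist_self]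
  · obtain ⟨d, hd⟩ := exists_isLatticePointBound f
    have hlim := ENNReal.tendsto_ofReal
      (tendsto_mul_log_add_div ((r : ℝ) ^ 2 - 1) (Real.log (16 / 3 * width f * d)))
    rw [ENNReal.ofReal_zero] at hlim
    refine tendsto_of_tendsto_of_tendsto_of_le_of_le' tendsto_const_nhds hlim
      (Eventually.of_forall fun _ => zero_le) ?_
    filter_upwards [eventually_ge_atTop 1] with n hn
    exact hausdorffEDist_le_ofReal (h₁ n hn) fun a ha =>
      exists_mem_amoeba_dist_lt hf hd hn (h₂ n hn ha)

end CyclicAmoeba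

open CyclicAmoeba in
theorem corollary3p7 (r : ℕ) (f : Laurent r) :
    (∀ n : ℕ, 1 ≤ n →
      amoeba f ⊆ nonLopsidedSet (cyclicResultant n f) ∧
      nonLopsidedSet (cyclicResultant n f) ⊆ nonSuperlopsidedSet (cyclicResultant n f)) ∧
    Tendsto (fun n : ℕ =>
      Metric.hausdorffEDist (nonSuperlopsidedSet (cyclicResultant n f)) (amoeba f))
      atTop (𝓝 0) ∧
    Tendsto (fun n : ℕ =>
      Metric.hausdorffEDist (nonLopsidedSet (cyclicResultant n f)) (amoeba f))
      atTop (𝓝 0) ∧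
    (f ≠ 0 → ∀ d : ℝ, IsLatticePointBound (newtonPolytope f) d → ∀ n : ℕ, 1 ≤ n →
      ∀ a ∈ nonSuperlopsidedSet (cyclicResultant n f), ∃ b ∈ amoeba f,
        dist a b <
          (((r : ℝ) ^ 2 - 1) * Real.log n + Real.log (16 / 3 * width f * d)) / n) := by
  have h₁ : ∀ n : ℕ, 1 ≤ n → amoeba f ⊆ nonLopsidedSet (cyclicResultant n f) := fun n hn =>
    (amoeba_subset_amoeba_cyclicResultant (by omega) f).trans (amoeba_subset_nonLopsidedSet _)
  have h₂ := fun n : ℕ => nonLopsidedSet_subset (cyclicResultant n f)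
  exact ⟨fun n hn => ⟨h₁ n hn, h₂ n⟩,
    tendsto_hausdorffEDist_amoeba f _ (fun n hn => (h₁ n hn).trans (h₂ n)) fun _ _ => subset_rfl,
    tendsto_hausdorffEDist_amoeba f _ h₁ fun n _ => h₂ n,
    fun hf d hd n hn a ha => exists_mem_amoeba_dist_lt hf hd hn ha⟩
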